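/- Let $X$ be a finite connected CW complex with cells $X_k$ in dimension $k$, each equipped with an orientation, and let $C_k(X;A)$ ($A=\mathbb Z,\mathbb R$) be its cellular chain groups with preferred basis $X_k$, with cycles $Z_k$ and boundaries $B_k$ ($B_{-1}=0$) and homology $H_k=Z_k/B_k$. Let $H_k(X;\mathbb Z)_0$ be the image of $H_k(X;\mathbb Z)\to H_k(X;\mathbb R)$, and let $\mathfrak h=(\mathfrak h_k)_{k\ge 0}$ be a combinatorial homology basis, i.e. $\mathfrak h_k$ is an (ordered) $\mathbb Z$-basis of $H_k(X;\mathbb Z)_0$ for each $k$. The Reidemeister torsion is $$\tau(X;\mathfrak h)=\prod_{k\ge 0}\det[\mathfrak b_k\mathfrak h_k\mathfrak b_{k-1}/\mathfrak c_k]^{(-1)^k},$$ where one chooses orderings $\mathfrak c_k$ of the cells, ordered bases $\mathfrak b_k$ of $B_k(X;\mathbb R)$, and linear splittings $s_{k-1}\colon B_{k-1}(X;\mathbb R)\to C_k(X;\mathbb R)$ of $\partial$ and $t_k\colon H_k(X;\mathbb R)\to Z_k(X;\mathbb R)$ of the quotient map, and $[\mathfrak b_k\mathfrak h_k\mathfrak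 b_{k-1}/\mathfrak c_k]$ is the matrix expressing the basis $\mathfrak b_k,\ t_k(\mathfrak h_k),\ s_{k-1}(\mathfrak b_{k-1})$ of $C_k(X;\mathbb R)$ in the basis $\mathfrak c_k$. Let $W_{kb}\in\mathbb R$ for $b\in X_k$, $k\ge 0$, be arbitrary weights, and give $C_k(X;\mathbb R)$ the modified inner product with $\langle b,b'\rangle_R=e^{W_{kb}}\delta_{bb'}$ for $b,b'\in X_k$. Let $\partial^*_R=e^{-W_{k+1}}\partial^* e^{W_k}$ be the adjoint of $\partial\colon C_{k+1}(X;\mathbb R)\to C_k(X;\mathbb R)$ for these inner products and let $$\mathcal L_k(W)=\partial\partial_R^*\colon B_k(X;\mathbb R)\to B_k(X;\mathbb R).$$ Let $H^R_k(X;\mathbb R)$ be the orthogonal complement of $B_k(X;\mathbb R)$ in $Z_k(X;\mathbb R)$ with respect to $\langle\,,\rangle_R$, identified with $H_k(X;\mathbb R)$ by sending a cycle to its class, and let $\eta_k$ be the square of the covolume of the lattice $H_k(X;\mathbb Z)_0\subset H^R_k(X;\mathbb R)$ with respect to the restriction of $\langle\,,\rangle_R$. Then, for every choice of orientations, orderings,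 bases $\mathfrak b_k$ and splittings as above, $$\tau^2(X;\mathfrak h)=\frac{\prod_{k\text{ even}}\det\mathcal L_k(W)}{\prod_{k\text{ odd}}\det\mathcal L_k(W)}\cdot\frac{\prod_{k\text{ odd}}\prod_{b\in X_k}e^{W_{kb}}}{\prod_{k\text{ even}}\prod_{b\in X_k}e^{W_{kb}}}\cdot\frac{\prod_{k\text{ even}}\eta_k}{\prod_{k\text{ odd}}\eta_k}.$$ -/

import Mathlib

open Topology

universe u

noncomputable section

/-! ### Relative singular homology of a pair of subspaces -/

/-- The integral singular chain complex of a topological space. -/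
def singularChains (Y : Type u) [TopologicalSpace Y] : ChainComplex (ModuleCat.{u} ℤ) ℕ :=
  ((AlgebraicTopology.singularChainComplexFunctor (ModuleCat.{u} ℤ)).obj
    (ModuleCat.of ℤ (ULift.{u} ℤ))).obj (TopCat.of Y)

/-- The boundary operator on singular chains. -/
def singularBoundary (Y : Type u) [TopologicalSpace Y] (i j : ℕ) :
    (singularChains Y).X i →+ (singularChains Y).X j :=
  ((singularChains Y).d i j).hom.toAddMonoidHom

/-- The homomorphism on singular chains induced by a continuous map. -/
def singularChainsMap {Y Y' : Type u} [TopologicalSpace Y] [TopologicalSpace Y'] (f : C(Y, Y'))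
    (k : ℕ) : (singularChains Y).X k →+ (singularChains Y').X k :=
  ((((AlgebraicTopology.singularChainComplexFunctor (ModuleCat.{u} ℤ)).obj
    (ModuleCat.of ℤ (ULift.{u} ℤ))).map (TopCat.ofHom f)).f k).hom.toAddMonoidHom

/-- The inclusion of a subspace as a continuous map. -/
def subspaceIncl {Y : Type u} [TopologicalSpace Y] (A : Set Y) : C(A, Y) :=
  ⟨Subtype.val, continuous_subtype_val⟩

/-- The singular `k`-chains of `Y` that come from the subspace `A`. -/
def chainsIn {Y : Type u} [TopologicalSpace Y] (A : Set Y) (k : ℕ) :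
    AddSubgroup ((singularChains Y).X k) :=
  (singularChainsMap (subspaceIncl A) k).range

/-- Relative cycles: chains of `A` whose boundary is a chain of `B`.  In degree `0` the
boundary operator `singularBoundary Y 0 (0 - 1)` is zero, so the second condition is void. -/
def relCycles {Y : Type u} [TopologicalSpace Y] (A B : Set Y) (k : ℕ) :
    AddSubgroup ((singularChains Y).X k) :=
  chainsIn A k ⊓ (chainsIn B (k - 1)).comap (singularBoundary Y k (k - 1))

/-- Relative boundaries: boundaries of chains of `A`, plus chains of `B`. -/
def relBoundaries {Y : Type u} [TopologicalSpace Y] (A B : Set Y) (k : ℕ) :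
    AddSubgroup ((singularChains Y).X k) :=
  (chainsIn A (k + 1)).map (singularBoundary Y (k + 1) k) ⊔ chainsIn B k

/-- The relative singular homology group `H_k(A, B; ℤ)` of subspaces `B ⊆ A` of `Y`. -/
abbrev RelHomology {Y : Type u} [TopologicalSpace Y] (A B : Set Y) (k : ℕ) : Type u :=
  relCycles A B k ⧸ (relBoundaries A B k).addSubgroupOf (relCycles A B k)

theorem singularChainsMap_boundary {Y Y' : Type u} [TopologicalSpace Y] [TopologicalSpace Y']
    (f : C(Y, Y')) (i j : ℕ) (c : (singularChains Y).X i) :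
    singularChainsMap f j (singularBoundary Y i j c)
      = singularBoundary Y' i j (singularChainsMap f i c) := by
  have h := congrArg ModuleCat.Hom.hom
    ((((AlgebraicTopology.singularChainComplexFunctor (ModuleCat.{u} ℤ)).obj
      (ModuleCat.of ℤ (ULift.{u} ℤ))).map (TopCat.ofHom f)).comm i j)
  exact (LinearMap.congr_fun h c).symm

theorem singularBoundary_boundary {Y : Type u} [TopologicalSpace Y] (i j k : ℕ)
    (c : (singularChains Y).X i) :
    singularBoundary Y j k (singularBoundary Y i j c) = 0 := by
  have h := congrArg ModuleCat.Hom.hom ((singularChains Y).d_comp_d i j k)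
  exact LinearMap.congr_fun h c

theorem singularChainsMap_comp {Y Y' Y'' : Type u} [TopologicalSpace Y] [TopologicalSpace Y']
    [TopologicalSpace Y''] (f : C(Y, Y')) (g : C(Y', Y'')) (k : ℕ) (c : (singularChains Y).X k) :
    singularChainsMap g k (singularChainsMap f k c) = singularChainsMap (g.comp f) k c := by
  have h := congrArg (fun m => HomologicalComplex.Hom.f m k)
    (((AlgebraicTopology.singularChainComplexFunctor (ModuleCat.{u} ℤ)).obj
      (ModuleCat.of ℤ (ULift.{u} ℤ))).map_comp (TopCat.ofHom f) (TopCat.ofHom g))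
  exact (LinearMap.congr_fun (congrArg ModuleCat.Hom.hom h) c).symm

theorem singularChainsMap_mem_chainsIn {Y Y' : Type u} [TopologicalSpace Y] [TopologicalSpace Y']
    (f : C(Y, Y')) {A : Set Y} {A' : Set Y'} (hA : Set.MapsTo f A A') {k : ℕ}
    {c : (singularChains Y).X k} (hc : c ∈ chainsIn A k) :
    singularChainsMap f k c ∈ chainsIn A' k := by
  obtain ⟨x, rfl⟩ := hc
  let g : C(A, A') := ⟨hA.restrict f A A', f.continuous.continuousOn.mapsToRestrict hA⟩
  refine ⟨singularChainsMap g k x, ?_⟩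
  rw [singularChainsMap_comp, singularChainsMap_comp]
  rfl

/-- The map on relative homology induced by a continuous map of pairs. -/
def RelHomology.map {Y Y' : Type u} [TopologicalSpace Y] [TopologicalSpace Y'] (f : C(Y, Y'))
    {A B : Set Y} {A' B' : Set Y'} (hA : Set.MapsTo f A A') (hB : Set.MapsTo f B B') (k : ℕ) :
    RelHomology A B k →+ RelHomology A' B' k :=
  QuotientAddGroup.map _ _
    (((singularChainsMap f k).comp (relCycles A B k).subtype).codRestrict (relCycles A' B' k)
      (fun c => ⟨singularChainsMap_mem_chainsIn f hA c.2.1, by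
        have h := singularChainsMap_mem_chainsIn f hB c.2.2
        rw [singularChainsMap_boundary] at h
        exact h⟩))
    (by
      rintro ⟨c, hc⟩ hcb
      obtain ⟨x, hx, y, hy, hxy⟩ := AddSubgroup.mem_sup.1 (AddSubgroup.mem_addSubgroupOf.1 hcb)
      obtain ⟨a, ha, rfl⟩ := hx
      refine AddSubgroup.mem_comap.2 (AddSubgroup.mem_addSubgroupOf.2 ?_)
      change singularChainsMap f k c ∈ relBoundaries A' B' k
      change _ = c at hxy
      rw [← hxy, map_add, singularChainsMap_boundary]
      exact AddSubgroup.add_mem_sup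
        ⟨_, singularChainsMap_mem_chainsIn f hA ha, rfl⟩ (singularChainsMap_mem_chainsIn f hB hy))

/-- The composite `H_{k+1}(A, B) → H_k(B) → H_k(B, E)`, `[c] ↦ [∂c]`, of the connecting map of
the pair `(A, B)` and the map to the homology of the pair `(B, E)`. -/
def RelHomology.connecting {Y : Type u} [TopologicalSpace Y] (A B E : Set Y) (k : ℕ) :
    RelHomology A B (k + 1) →+ RelHomology B E k :=
  QuotientAddGroup.map _ _
    (((singularBoundary Y (k + 1) k).comp (relCycles A B (k + 1)).subtype).codRestrict
      (relCycles B E k) (fun c => ⟨c.2.2, by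
        refine AddSubgroup.mem_comap.2 ?_
        change singularBoundary Y k (k - 1) (singularBoundary Y (k + 1) k c.1) ∈ _
        rw [singularBoundary_boundary]
        exact zero_mem _⟩))
    (by
      rintro ⟨c, hc⟩ hcb
      obtain ⟨x, hx, y, hy, hxy⟩ := AddSubgroup.mem_sup.1 (AddSubgroup.mem_addSubgroupOf.1 hcb)
      obtain ⟨a, ha, rfl⟩ := hx
      refine AddSubgroup.mem_comap.2 (AddSubgroup.mem_addSubgroupOf.2 ?_)
      change singularBoundary Y (k + 1) k c ∈ relBoundaries B E k
      change _ = c at hxy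
      rw [← hxy, map_add, singularBoundary_boundary, zero_add]
      exact AddSubgroup.mem_sup_left ⟨y, hy, rfl⟩)

theorem RelHomology.connecting_connecting {Y : Type u} [TopologicalSpace Y] (A B E F : Set Y)
    (k : ℕ) (x : RelHomology A B (k + 1 + 1)) :
    RelHomology.connecting B E F k (RelHomology.connecting A B E (k + 1) x) = 0 := by
  obtain ⟨⟨c, hc⟩, rfl⟩ := QuotientAddGroup.mk_surjective x
  refine (QuotientAddGroup.eq_zero_iff _).2 (AddSubgroup.mem_addSubgroupOf.2 ?_)
  change singularBoundary Y (k + 1) k (singularBoundary Y (k + 1 + 1) (k + 1) c) ∈ _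
  rw [singularBoundary_boundary]
  exact zero_mem _

/-! ### The cellular chain complex of a CW complex -/

/-- The closed `k`-disk (in the convention used for characteristic maps of CW complexes: the
closed unit ball of `Fin k → ℝ`), in an arbitrary universe. -/
abbrev Disk (k : ℕ) : Type u := ULift.{u} (Metric.closedBall (0 : Fin k → ℝ) 1)

/-- The boundary sphere of the disk. -/
def diskSphere (k : ℕ) : Set (Disk.{u} k) := {x | x.down.1 ∈ Metric.sphere (0 : Fin k → ℝ) 1}

/-- The characteristic map of a cell, as a continuous map on the closed disk. -/
def characteristicMap {X : Type u} [TopologicalSpace X] (C : Set X) [CWComplex C] (k : ℕ)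
    (e : RelCWComplex.cell C k) : C(Disk.{u} k, X) :=
  ⟨fun x => RelCWComplex.map k e x.down.1,
    (RelCWComplex.continuousOn k e).comp_continuous
      (continuous_subtype_val.comp continuous_uliftDown) (fun x => x.down.2)⟩

/-- An orientation of each cell: a choice of a generator of `H_k(D^k, S^{k-1}; ℤ)` (which is
infinite cyclic) for each `k`-cell. -/
structure CellOrientation {X : Type u} [TopologicalSpace X] (C : Set X) [CWComplex C] where
  gen : ∀ k : ℕ, RelCWComplex.cell C k → RelHomology (Set.univ : Set (Disk.{u} k)) (diskSphere k) k
  generates : ∀ k e, AddSubgroup.zmultiples (gen k e) = ⊤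

/-- The cellular chain group `H_k(X^(k), X^(k-1); ℤ)`.  Here `skeletonLT C (k + 1)` is the
`k`-skeleton and `skeletonLT C k` is the `(k - 1)`-skeleton (empty for `k = 0`). -/
abbrev CellularChainGroup {X : Type u} [TopologicalSpace X] [T2Space X] (C : Set X) [CWComplex C]
    (k : ℕ) : Type u :=
  RelHomology (RelCWComplex.skeletonLT C ((k + 1 : ℕ) : ℕ∞) : Set X)
    (RelCWComplex.skeletonLT C (k : ℕ∞) : Set X) k

/-- The class of an oriented `k`-cell in `H_k(X^(k), X^(k-1); ℤ)`: the image of the chosen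
generator of `H_k(D^k, S^{k-1}; ℤ)` under the characteristic map. -/
def cellClass {X : Type u} [TopologicalSpace X] [T2Space X] {C : Set X} [CWComplex C]
    (o : CellOrientation C) (k : ℕ) (e : RelCWComplex.cell C k) : CellularChainGroup C k :=
  RelHomology.map (characteristicMap C k e)
    (A' := (RelCWComplex.skeletonLT C ((k + 1 : ℕ) : ℕ∞) : Set X))
    (B' := (RelCWComplex.skeletonLT C (k : ℕ∞) : Set X))
    (fun x _ => by
      have h := RelCWComplex.closedCell_subset_skeletonLT k e
      exact_mod_cast h (show characteristicMap C k e x ∈ _ from ⟨x.down.1, x.down.2, rfl⟩))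
    (fun x hx => RelCWComplex.cellFrontier_subset_skeletonLT k e
      (show characteristicMap C k e x ∈ _ from ⟨x.down.1, hx, rfl⟩)) k (o.gen k e)

instance {X : Type u} [TopologicalSpace X] (C : Set X) [CWComplex C] [RelCWComplex.Finite C]
    (k : ℕ) : Fintype (RelCWComplex.cell C k) :=
  letI : Finite (RelCWComplex.cell C k) := RelCWComplex.FiniteType.finite_cell (C := C) k
  Fintype.ofFinite (RelCWComplex.cell C k)

/-- The comparison `ℤ^{X_k} → H_k(X^(k), X^(k-1); ℤ)` sending a cell to its class. -/
def cellComparison {X : Type u} [TopologicalSpace X] [T2Space X] {C : Set X} [CWComplex C]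
    [RelCWComplex.Finite C] (o : CellOrientation C) (k : ℕ) :
    (RelCWComplex.cell C k → ℤ) →+ CellularChainGroup C k where
  toFun x := ∑ e, x e • cellClass o k e
  map_zero' := by simp
  map_add' x y := by simp only [Pi.add_apply, add_zsmul, Finset.sum_add_distrib]

open Classical in
/-- The identification `H_k(X^(k), X^(k-1); ℤ) → ℤ^{X_k}` of the cellular chain group with the
free group on the cells: the inverse of `cellComparison`, which is an isomorphism by a
classical theorem.  (To be able to write the inverse as a total function we give it the
value `0` should `cellComparison` fail to be bijective, a case which does not occur.) -/
def cellCoordinates {X : Type u} [TopologicalSpace X] [T2Space X] {C : Set X} [CWComplex C]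
    [RelCWComplex.Finite C] (o : CellOrientation C) (k : ℕ) :
    CellularChainGroup C k →+ (RelCWComplex.cell C k → ℤ) :=
  if h : Function.Bijective (cellComparison o k) then
    ((AddEquiv.ofBijective (cellComparison o k) h).symm : _ →+ _)
  else 0

/-- The cellular boundary operator `C_{k+1}(X; ℤ) → C_k(X; ℤ)` in terms of the cells: the
connecting map `H_{k+1}(X^(k+1), X^(k)) → H_k(X^(k), X^(k-1))` of the triple of skeleta. -/
def cellularBoundary {X : Type u} [TopologicalSpace X] [T2Space X] {C : Set X} [CWComplex C]
    [RelCWComplex.Finite C] (o : CellOrientation C) (k : ℕ) :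
    (RelCWComplex.cell C (k + 1) → ℤ) →+ (RelCWComplex.cell C k → ℤ) :=
  (cellCoordinates o k).comp
    ((RelHomology.connecting _ _ _ k).comp (cellComparison o (k + 1)))

theorem cellularBoundary_cellularBoundary {X : Type u} [TopologicalSpace X] [T2Space X] {C : Set X}
    [CWComplex C] [RelCWComplex.Finite C] (o : CellOrientation C) (k : ℕ)
    (x : RelCWComplex.cell C (k + 1 + 1) → ℤ) :
    cellularBoundary o k (cellularBoundary o (k + 1) x) = 0 := by
  by_cases h : Function.Bijective (cellComparison o (k + 1))
  · have hinv : ∀ y, cellComparison o (k + 1) (cellCoordinates o (k + 1) y) = y := by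
      intro y
      rw [cellCoordinates, dif_pos h]
      exact (AddEquiv.ofBijective (cellComparison o (k + 1)) h).apply_symm_apply y
    simp only [cellularBoundary, AddMonoidHom.comp_apply, hinv]
    rw [RelHomology.connecting_connecting, map_zero]
  · have h0 : cellCoordinates o (k + 1) = 0 := by rw [cellCoordinates, dif_neg h]
    simp only [cellularBoundary, AddMonoidHom.comp_apply, h0, AddMonoidHom.zero_apply, map_zero]

/-- A non-negatively graded chain complex of finitely generated free abelian groups with a
preferred basis `cells k` in each degree `k`, given by its boundary matrices. -/
structure BasedComplex where
  cells : ℕ → Type u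
  fintypeCells : ∀ k, Fintype (cells k)
  decEqCells : ∀ k, DecidableEq (cells k)
  bd : ∀ k, Matrix (cells k) (cells (k + 1)) ℤ
  bd_mul_bd : ∀ k, bd k * bd (k + 1) = 0

instance (K : BasedComplex.{u}) (k : ℕ) : Fintype (K.cells k) := K.fintypeCells k
instance (K : BasedComplex.{u}) (k : ℕ) : DecidableEq (K.cells k) := K.decEqCells k

open Classical in
/-- The cellular chain complex of a finite CW complex with oriented cells, with its preferred
basis consisting of the cells. -/
def cellularComplex {X : Type u} [TopologicalSpace X] [T2Space X] {C : Set X} [CWComplex C]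
    [RelCWComplex.Finite C] (o : CellOrientation C) : BasedComplex.{u} where
  cells k := RelCWComplex.cell C k
  fintypeCells := inferInstance
  decEqCells := inferInstance
  bd k := Matrix.of fun e e' => cellularBoundary o k (Pi.single e' 1) e
  bd_mul_bd k := by
    ext e e''
    have key : ∀ x : RelCWComplex.cell C (k + 1) → ℤ, cellularBoundary o k x e =
        ∑ e', cellularBoundary o k (Pi.single e' 1) e * x e' := by
      intro x
      conv_lhs => rw [pi_eq_sum_univ' x]
      simp only [map_sum, map_zsmul, Finset.sum_apply, Pi.smul_apply, smul_eq_mul]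
      refine Finset.sum_congr rfl fun e' _ => ?_
      rw [mul_comm]
    have h := congrFun (cellularBoundary_cellularBoundary o k (Pi.single e'' 1)) e
    rw [key] at h
    exact h

namespace BasedComplex

variable (K : BasedComplex.{u})

/-! ### Cycles, boundaries and homology -/

/-- The boundary operator `C_{k+1}(K; A) → C_k(K; A)` with coefficients in `A`. -/
def boundary (A : Type) [CommRing A] (k : ℕ) :
    (K.cells (k + 1) → A) →ₗ[A] (K.cells k → A) :=
  ((K.bd k).map (Int.cast : ℤ → A)).mulVecLin

/-- The `k`-cycles `Z_k(K; A)`. -/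
def cycles (A : Type) [CommRing A] : ∀ k : ℕ, Submodule A (K.cells k → A)
  | 0 => ⊤
  | k + 1 => LinearMap.ker (K.boundary A k)

/-- The `k`-boundaries `B_k(K; A)`. -/
def boundaries (A : Type) [CommRing A] (k : ℕ) : Submodule A (K.cells k → A) :=
  LinearMap.range (K.boundary A k)

/-- The homology `H_k(K; A) = Z_k / B_k`. -/
abbrev Homology (A : Type) [CommRing A] (k : ℕ) : Type u :=
  K.cycles A k ⧸ (K.boundaries A k).submoduleOf (K.cycles A k)

/-- The homology class of a cycle. -/
def homologyClass (A : Type) [CommRing A] (k : ℕ) : K.cycles A k →ₗ[A] K.Homology A k :=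
  Submodule.mkQ _

theorem boundary_boundary (A : Type) [CommRing A] (k : ℕ) (x : K.cells (k + 1 + 1) → A) :
    K.boundary A k (K.boundary A (k + 1) x) = 0 := by
  have h := congrArg (fun M => M.map (Int.castRingHom A)) (K.bd_mul_bd k)
  simp only [Matrix.map_mul] at h
  simp only [boundary, Matrix.mulVecLin_apply, Matrix.mulVec_mulVec]
  erw [h]
  simp

theorem boundaries_le_cycles (A : Type) [CommRing A] (k : ℕ) :
    K.boundaries A k ≤ K.cycles A k := by
  cases k with
  | zero => exact le_top
  | succ k =>
    rintro _ ⟨x, rfl⟩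
    exact K.boundary_boundary A k x

theorem boundary_intCast (k : ℕ) (x : K.cells (k + 1) → ℤ) :
    K.boundary ℝ k (fun e => (x e : ℝ)) = fun e => ((K.boundary ℤ k x e : ℤ) : ℝ) := by
  funext e
  simp [boundary, Matrix.mulVec, dotProduct]

/-- The inclusion of integral chains into real chains. -/
def chainsIntCast (k : ℕ) : (K.cells k → ℤ) →ₗ[ℤ] (K.cells k → ℝ) :=
  (Int.castAddHom ℝ).toIntLinearMap.compLeft (K.cells k)

theorem chainsIntCast_mem_cycles (k : ℕ) (x : K.cells k → ℤ) (hx : x ∈ K.cycles ℤ k) :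
    K.chainsIntCast k x ∈ K.cycles ℝ k := by
  cases k with
  | zero => trivial
  | succ k =>
    change K.boundary ℝ k (fun e => (x e : ℝ)) = 0
    rw [boundary_intCast, show K.boundary ℤ k x = 0 from hx]
    simp; rfl

/-- The homomorphism from integral cycles to real homology, `z ↦ [z]`. -/
def integralCycleClass (k : ℕ) : K.cycles ℤ k →ₗ[ℤ] K.Homology ℝ k :=
  AddMonoidHom.toIntLinearMap
    { toFun := fun z =>
        K.homologyClass ℝ k ⟨K.chainsIntCast k z.1, K.chainsIntCast_mem_cycles k z.1 z.2⟩
      map_zero' := by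
        rw [← map_zero (K.homologyClass ℝ k)]
        congr 1
        ext1
        exact map_zero _
      map_add' := fun x y => by
        rw [← map_add]
        congr 1
        ext1
        exact map_add (K.chainsIntCast k) x.1 y.1 }

/-- The evident homomorphism `H_k(K; ℤ) → H_k(K; ℝ)`. -/
def homologyIntCast (k : ℕ) : K.Homology ℤ k →ₗ[ℤ] K.Homology ℝ k :=
  Submodule.liftQ _ (K.integralCycleClass k) (by
    rintro ⟨z, hz⟩ ⟨x, hx⟩
    refine (Submodule.Quotient.mk_eq_zero _).2 ⟨fun e => (x e : ℝ), ?_⟩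
    rw [boundary_intCast, hx]
    rfl)

/-- `H_k(K; ℤ)_0`, the image of `H_k(K; ℤ) → H_k(K; ℝ)`. -/
def integralHomology (k : ℕ) : Submodule ℤ (K.Homology ℝ k) :=
  LinearMap.range (K.homologyIntCast k)

/-- The Betti number `β_k`, the dimension of `H_k(K; ℝ)`. -/
def betti (k : ℕ) : ℕ := Module.finrank ℝ (K.Homology ℝ k)

/-- The dimension of `B_k(K; ℝ)`. -/
def bdRank (k : ℕ) : ℕ := Module.finrank ℝ (K.boundaries ℝ k)

/-- The dimension of `B_{k-1}(K; ℝ)`, where `B_{-1} = 0`. -/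
def prevBdRank : ℕ → ℕ
  | 0 => 0
  | k + 1 => K.bdRank k

/-- An (ordered) combinatorial homology basis: a `ℤ`-basis of `H_k(K; ℤ)_0` for all `k`. -/
abbrev CombinatorialBasis : Type u :=
  ∀ k : ℕ, Module.Basis (Fin (K.betti k)) ℤ (K.integralHomology k)

/-! ### Reidemeister torsion -/

theorem card_cells (k : ℕ) :
    K.bdRank k + K.betti k + K.prevBdRank k = Fintype.card (K.cells k) := by
  have h1 : K.betti k + K.bdRank k = Module.finrank ℝ (K.cycles ℝ k) := by
    have h := Submodule.finrank_quotient_add_finrank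
      ((K.boundaries ℝ k).submoduleOf (K.cycles ℝ k))
    rw [(Submodule.submoduleOfEquivOfLe (K.boundaries_le_cycles ℝ k)).finrank_eq] at h
    exact h
  have h2 : K.prevBdRank k + Module.finrank ℝ (K.cycles ℝ k) = Fintype.card (K.cells k) := by
    cases k with
    | zero =>
      rw [prevBdRank, zero_add, cycles]
      exact (finrank_top ℝ _).trans (Module.finrank_fintype_fun_eq_card ℝ)
    | succ k =>
      have h := LinearMap.finrank_range_add_finrank_ker (K.boundary ℝ k)
      rw [Module.finrank_fintype_fun_eq_card] at h
      exact h
  omega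

/-- The auxiliary choices in the definition of the torsion: an ordering of the cells, ordered
bases `b_k` of the spaces `B_k` of boundaries, splittings `s_k` of `∂ : C_{k+1} → B_k` and
splittings `t_k` of `Z_k → H_k`. -/
structure TorsionChoices where
  order : ∀ k, Fin (Fintype.card (K.cells k)) ≃ K.cells k
  b : ∀ k, Module.Basis (Fin (K.bdRank k)) ℝ (K.boundaries ℝ k)
  s : ∀ k, K.boundaries ℝ k →ₗ[ℝ] (K.cells (k + 1) → ℝ)
  boundary_s : ∀ k x, K.boundary ℝ k (s k x) = x
  t : ∀ k, K.Homology ℝ k →ₗ[ℝ] K.cycles ℝ k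
  homologyClass_t : ∀ k x, K.homologyClass ℝ k (t k x) = x

variable {K}

/-- The vectors `s_{k-1}(b_{k-1}^i)` of `C_k`; there are none if `k = 0`. -/
def TorsionChoices.liftedBasis (c : K.TorsionChoices) :
    ∀ k, Fin (K.prevBdRank k) → (K.cells k → ℝ)
  | 0 => fun i => i.elim0
  | k + 1 => fun i => c.s k (c.b k i)

/-- The vectors `b_k`, `t_k(h_k)`, `s_{k-1}(b_{k-1})` of `C_k`, concatenated in this order. -/
def TorsionChoices.combinedBasis (c : K.TorsionChoices)
    (h : ∀ k, Fin (K.betti k) → K.Homology ℝ k) (k : ℕ) :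
    Fin (K.bdRank k + K.betti k + K.prevBdRank k) → (K.cells k → ℝ) :=
  Fin.append
    (Fin.append (fun i => (c.b k i : K.cells k → ℝ)) (fun i => (c.t k (h k i) : K.cells k → ℝ)))
    (c.liftedBasis k)

/-- The change of basis matrix `[b_k h_k b_{k-1} / c_k]`: its `j`-th column consists of the
coordinates of the `j`-th vector of `b_k h_k b_{k-1}` in the basis of cells. -/
def TorsionChoices.changeOfBasis (c : K.TorsionChoices)
    (h : ∀ k, Fin (K.betti k) → K.Homology ℝ k) (k : ℕ) :
    Matrix (Fin (Fintype.card (K.cells k))) (Fin (Fintype.card (K.cells k))) ℝ :=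
  Matrix.of fun i j => c.combinedBasis h k (Fin.cast (K.card_cells k).symm j) (c.order k i)

/-- Milnor's torsion `∏_{k ≥ 0} det [b_k h_k b_{k-1} / c_k] ^ ((-1)^k)`, where `h_k` is a basis
of `H_k(K; ℝ)`. -/
def torsion (c : K.TorsionChoices) (h : ∀ k, Fin (K.betti k) → K.Homology ℝ k) : ℝ :=
  ∏ᶠ k : ℕ, (c.changeOfBasis h k).det ^ ((-1 : ℤ) ^ k)

end BasedComplex

/-! ### The modified inner product -/

/-- The space of real chains `ι → ℝ` on a finite set `ι` of cells, with the modified inner product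
`⟨x, y⟩ = ∑ b, exp (w b) * x b * y b`. -/
def WeightedChains {ι : Type u} (_w : ι → ℝ) : Type u := ι → ℝ

namespace WeightedChains

variable {ι : Type u} [Fintype ι] (w : ι → ℝ)

instance : AddCommGroup (WeightedChains w) := inferInstanceAs (AddCommGroup (ι → ℝ))
instance : Module ℝ (WeightedChains w) := inferInstanceAs (Module ℝ (ι → ℝ))

/-- The identity map from chains to chains with the modified inner product. -/
def of : (ι → ℝ) ≃ₗ[ℝ] WeightedChains w := LinearEquiv.refl ℝ (ι → ℝ)

/-- The modified inner product. -/
@[reducible] def core : InnerProductSpace.Core ℝ (WeightedChains w) where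
  inner x y := ∑ b, Real.exp (w b) * (of w).symm x b * (of w).symm y b
  conj_inner_symm x y := by
    simp only [conj_trivial]
    exact Finset.sum_congr rfl fun b _ => by ring
  re_inner_nonneg x := by
    simp only [RCLike.re_to_real]
    refine Finset.sum_nonneg fun b _ => ?_
    rw [mul_assoc]
    exact mul_nonneg (Real.exp_pos _).le (mul_self_nonneg _)
  add_left x y z := by
    simp only [map_add, Pi.add_apply, ← Finset.sum_add_distrib]
    exact Finset.sum_congr rfl fun b _ => by ring
  smul_left x y r := by
    simp only [map_smul, Pi.smul_apply, smul_eq_mul, conj_trivial, Finset.mul_sum]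
    exact Finset.sum_congr rfl fun b _ => by ring
  definite x hx := by
    have h := (Finset.sum_eq_zero_iff_of_nonneg (fun b _ => by
      rw [mul_assoc]
      exact mul_nonneg (Real.exp_pos _).le (mul_self_nonneg _))).1 hx
    apply (of w).symm.injective
    rw [map_zero]
    funext b
    have hb := h b (Finset.mem_univ b)
    rw [mul_assoc] at hb
    exact mul_self_eq_zero.1 ((mul_eq_zero.1 hb).resolve_left (Real.exp_pos _).ne')

instance : NormedAddCommGroup (WeightedChains w) := (core w).toNormedAddCommGroup
instance : InnerProductSpace ℝ (WeightedChains w) := InnerProductSpace.ofCore (core w).toCore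
instance : FiniteDimensional ℝ (WeightedChains w) := Module.Finite.equiv (of w)
instance : MeasurableSpace (WeightedChains w) := borel _
instance : BorelSpace (WeightedChains w) := ⟨rfl⟩

end WeightedChains

namespace BasedComplex

variable (K : BasedComplex.{u}) (W : ∀ k, K.cells k → ℝ)

/-- The real boundary operator between the chain spaces with the modified inner products. -/
def boundaryW (k : ℕ) : WeightedChains (W (k + 1)) →ₗ[ℝ] WeightedChains (W k) :=
  (WeightedChains.of (W k)).toLinearMap ∘ₗ K.boundary ℝ k ∘ₗ
    (WeightedChains.of (W (k + 1))).symm.toLinearMap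

/-- `B_k(K; ℝ)` as a subspace of the chains with the modified inner product. -/
def boundariesW (k : ℕ) : Submodule ℝ (WeightedChains (W k)) :=
  (K.boundaries ℝ k).map (WeightedChains.of (W k)).toLinearMap

/-- `Z_k(K; ℝ)` as a subspace of the chains with the modified inner product. -/
def cyclesW (k : ℕ) : Submodule ℝ (WeightedChains (W k)) :=
  (K.cycles ℝ k).map (WeightedChains.of (W k)).toLinearMap

/-- The formal adjoint `∂*_R` of `∂ : C_{k+1} → C_k` in the modified inner products. -/
def coboundaryW (k : ℕ) : WeightedChains (W k) →ₗ[ℝ] WeightedChains (W (k + 1)) :=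
  LinearMap.adjoint (K.boundaryW W k)

/-- The operator `𝓛_k(W) = ∂ ∂*_R : B_k(K; ℝ) → B_k(K; ℝ)`. -/
def laplacian (k : ℕ) : K.boundariesW W k →ₗ[ℝ] K.boundariesW W k :=
  (K.boundaryW W k ∘ₗ K.coboundaryW W k).restrict (fun x _ =>
    ⟨_, ⟨(WeightedChains.of (W (k + 1))).symm (K.coboundaryW W k x), rfl⟩, rfl⟩)

/-- `H^R_k(K; ℝ)`: the orthogonal complement of `B_k` in `Z_k` for the modified inner product. -/
def harmonic (k : ℕ) : Submodule ℝ (WeightedChains (W k)) :=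
  K.cyclesW W k ⊓ (K.boundariesW W k)ᗮ

theorem harmonic_mem_cycles (k : ℕ) (x : K.harmonic W k) :
    (WeightedChains.of (W k)).symm x.1 ∈ K.cycles ℝ k := by
  obtain ⟨y, hy, hxy⟩ := x.2.1
  rw [← hxy]
  exact hy

/-- The identification `H^R_k(K; ℝ) → H_k(K; ℝ)` sending a cycle to its homology class. -/
def harmonicClass (k : ℕ) : K.harmonic W k →ₗ[ℝ] K.Homology ℝ k :=
  K.homologyClass ℝ k ∘ₗ
    ((WeightedChains.of (W k)).symm.toLinearMap ∘ₗ (K.harmonic W k).subtype).codRestrict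
      (K.cycles ℝ k) (K.harmonic_mem_cycles W k)

/-- The lattice `H_k(K; ℤ)_0` inside `H^R_k(K; ℝ) ≅ H_k(K; ℝ)`. -/
def harmonicLattice (k : ℕ) : Submodule ℤ (K.harmonic W k) :=
  (K.integralHomology k).comap (K.harmonicClass W k).toAddMonoidHom.toIntLinearMap

/-- `η_k`: the square of the covolume of the lattice `H_k(K; ℤ)_0 ⊂ H^R_k(K; ℝ)`, with respect to
the volume of the (restricted) modified inner product. -/
def eta (k : ℕ) : ℝ := ZLattice.covolume (K.harmonicLattice W k) ^ 2

end BasedComplex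

end

/-! The formula is pure linear algebra of a based complex. In degree `k`, the cells are orthogonal
with squared norms `exp (W k b)`, so the squared determinant of the change of basis times `∏ exp (W
k b)` is the Gram determinant of `b_k, t_k(h_k), s_{k-1}(b_{k-1})`. A Gram determinant is unchanged
when vectors are corrected by elements of the span of the earlier ones. Hence `t_k(h_k)` may be
replaced by harmonic representatives, and the lifts by their projections to the complement of `Z_k`;
the Gram determinant then splits as `G_k * η_k * p_k` (`TorsionChoices.det_changeOfBasis_sq_eq`),
with `G_k` that of `b_k` and `p_k` that of the projected lifts.

The factor `η_k` appears because the harmonic representatives span the lattice (`eta_eq_det_gram`).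
The Laplacian appears because the projected lifts lie in `(ker ∂)ᗮ` and map to `b_k`, so that `G_k =
p_{k+1} * det 𝓛_k` (`TorsionChoices.exists_lift`).

The choices therefore contribute only `p_k * p_{k+1}` in degree `k`. In the alternating product
these factors telescope to `1`, since `p_0 = 1` and the complex is zero in high degrees. -/

/-! ### Gram determinants, covolumes and adjoints -/

open Matrix in
theorem gram_sum_smul {E ι κ : Type*} [NormedAddCommGroup E] [InnerProductSpace ℝ E] [Fintype ι]
    (f : ι → E) (M : Matrix ι κ ℝ) :
    gram ℝ (fun j => ∑ i, M i j • f i) = Mᵀ * gram ℝ f * M := by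
  ext j j'
  simp only [gram_apply, Matrix.mul_apply, sum_inner, inner_sum, real_inner_smul_left,
    real_inner_smul_right, transpose_apply, Finset.sum_mul]
  exact Finset.sum_congr rfl fun i _ => Finset.sum_congr rfl fun i' _ => by ring

open Matrix in
/-- The Gram determinant of `u, v` is that of `u` times that of the orthogonal projection of `v` to
the complement of the span of `u`. -/
theorem det_gram_sumElim {E ι κ : Type*} [NormedAddCommGroup E] [InnerProductSpace ℝ E]
    [Fintype ι] [DecidableEq ι] [Fintype κ] [DecidableEq κ] (u : ι → E) (v v' : κ → E)
    (hspan : ∀ j, v j - v' j ∈ Submodule.span ℝ (Set.range u))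
    (horth : ∀ i j, inner ℝ (u i) (v' j) = 0) :
    (gram ℝ (Sum.elim u v)).det = (gram ℝ u).det * (gram ℝ v').det := by
  choose c hc using fun j => (Submodule.mem_span_range_iff_exists_fun ℝ).1 (hspan j)
  -- A block unitriangular matrix, of determinant one, carries `u, v'` to `u, v`; the Gram matrix of
  -- `u, v'` is block diagonal.
  have hv : Sum.elim u v = fun j => ∑ i, (fromBlocks 1 (Matrix.of fun i j => c j i) 0 1 :
      Matrix (ι ⊕ κ) (ι ⊕ κ) ℝ) i j • Sum.elim u v' i := by
    funext j
    cases j with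
    | inl j => simp [Matrix.one_apply]
    | inr j => simp [Matrix.one_apply, hc]
  have hg : gram ℝ (Sum.elim u v') = fromBlocks (gram ℝ u) 0 0 (gram ℝ v') := by
    ext i j
    cases i <;> cases j <;> simp [horth, real_inner_comm]
  rw [hv, gram_sum_smul, hg]
  simp [det_transpose]

open Matrix in
theorem det_gram_comp_equiv {E ι κ : Type*} [NormedAddCommGroup E] [InnerProductSpace ℝ E]
    [Fintype ι] [DecidableEq ι] [Fintype κ] [DecidableEq κ] (f : ι → E) (e : κ ≃ ι) :
    (gram ℝ (f ∘ e)).det = (gram ℝ f).det :=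
  det_submatrix_equiv_self e (gram ℝ f)

open Matrix in
/-- The square of the covolume of a lattice spanned by a basis is the Gram determinant. -/
theorem covolume_sq_eq_det_gram {E ι : Type*} [NormedAddCommGroup E] [InnerProductSpace ℝ E]
    [FiniteDimensional ℝ E] [MeasurableSpace E] [BorelSpace E] [Fintype ι] [DecidableEq ι]
    (b : Module.Basis ι ℝ E) (L : Submodule ℤ E) (hL : L = Submodule.span ℤ (Set.range b)) :
    ZLattice.covolume L ^ 2 = (gram ℝ b).det := by
  subst hL
  let e : Fin (Module.finrank ℝ E) ≃ ι :=
    Fintype.equivOfCardEq (by rw [Fintype.card_fin, Module.finrank_eq_card_basis b])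
  let o : OrthonormalBasis ι ℝ E := (stdOrthonormalBasis ℝ E).reindex e
  let bz : Module.Basis ι ℤ (Submodule.span ℤ (Set.range b)) := b.restrictScalars ℤ
  have hb : ((↑) ∘ bz : ι → E) = b := by
    funext i
    exact b.restrictScalars_apply ℤ i
  -- Relative to an orthonormal basis the covolume is `|det P|`, where `P` is the coordinate matrix
  -- of `b`, while the Gram matrix is `Pᵀ * P`.
  rw [ZLattice.covolume_eq_det_mul_measureReal _ _ bz o.toBasis, hb,
    MeasureTheory.measureReal_congr (ZSpan.fundamentalDomain_ae_parallelepiped _ _),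
    gram_eq_conjTranspose_mul o]
  have h1 : MeasureTheory.volume.real (parallelepiped o.toBasis) = 1 := by
    simp [MeasureTheory.measureReal_def, o.volume_parallelepiped]
  rw [h1, mul_one, sq_abs, det_mul, conjTranspose_eq_transpose_of_trivial, det_transpose, ← sq]
  rfl

open Matrix in
/-- If the vectors `w i` lie in the orthogonal complement of `ker D` and `D (w i) = b i` for a basis
`b` of the range of `D`, then `det gram w * det (D D*) = det gram b`. -/
theorem det_gram_mul_det_comp_adjoint {E F ι : Type*} [NormedAddCommGroup E]
    [InnerProductSpace ℝ E] [FiniteDimensional ℝ E] [NormedAddCommGroup F] [InnerProductSpace ℝ F]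
    [FiniteDimensional ℝ F] [Fintype ι] [DecidableEq ι] (D : E →ₗ[ℝ] F) (B : Submodule ℝ F)
    (b : Module.Basis ι ℝ B) (L : B →ₗ[ℝ] B)
    (hL : ∀ x, (L x : F) = D (LinearMap.adjoint D (x : F))) (w : ι → E)
    (hw : ∀ i, w i ∈ (LinearMap.ker D)ᗮ) (hDw : ∀ i, D (w i) = b i) :
    (gram ℝ w).det * LinearMap.det L = (gram ℝ fun i => (b i : F)).det := by
  -- Both sides lie in `(ker D)ᗮ` and have the same image `L (b j)` under `D`, so their difference
  -- is orthogonal to itself.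
  have key : ∀ j, LinearMap.adjoint D (b j : F) = ∑ l, LinearMap.toMatrix b b L l j • w l := by
    intro j
    rw [← sub_eq_zero]
    set z := LinearMap.adjoint D (b j : F) - ∑ l, LinearMap.toMatrix b b L l j • w l with hz
    have hz1 : z ∈ (LinearMap.ker D)ᗮ := by
      refine Submodule.sub_mem _ ?_ (Submodule.sum_mem _ fun l _ => Submodule.smul_mem _ _ (hw l))
      refine (Submodule.mem_orthogonal _ _).2 fun x hx => ?_
      rw [LinearMap.adjoint_inner_right, LinearMap.mem_ker.1 hx, inner_zero_left]
    have hz2 : z ∈ LinearMap.ker D := by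
      rw [LinearMap.mem_ker, hz, map_sub, ← hL, map_sum, sub_eq_zero]
      simp only [map_smul, hDw, LinearMap.toMatrix_apply]
      refine (congrArg Subtype.val (b.sum_repr (L (b j)))).symm.trans ?_
      simp only [Submodule.coe_sum, Submodule.coe_smul]
    exact inner_self_eq_zero.1 ((Submodule.mem_orthogonal _ _).1 hz1 z hz2)
  -- Since `b i = D (w i)`, the adjoint moves `D` across the inner product, and `key` expands the
  -- result in the `w l`.
  have hg : gram ℝ (fun i => (b i : F)) = gram ℝ w * LinearMap.toMatrix b b L := by
    ext i j
    rw [gram_apply, ← hDw i, ← LinearMap.adjoint_inner_right, key, inner_sum, Matrix.mul_apply]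
    simp only [real_inner_smul_right, gram_apply]
    exact Finset.sum_congr rfl fun l _ => mul_comm _ _
  rw [hg, det_mul, LinearMap.det_toMatrix]

/-! ### Integral cycles and bases of real homology -/

/-- The real kernel of an integral matrix is spanned by its integral kernel. -/
theorem ker_intCast_le_span {m n : Type*} [Fintype n] (A : Matrix m n ℤ) (x : n → ℝ)
    (hx : (A.map (Int.cast : ℤ → ℝ)).mulVec x = 0) :
    x ∈ Submodule.span ℝ {y : n → ℝ | ∃ z : n → ℤ, A.mulVec z = 0 ∧ y = fun e => (z e : ℝ)} := by
  classical
  let b := Module.Basis.ofVectorSpace ℚ ℝ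
  -- the coefficient vectors of `x` with respect to a basis of `ℝ` over `ℚ`
  let q : Module.Basis.ofVectorSpaceIndex ℚ ℝ → n → ℚ := fun j e => b.repr (x e) j
  let s : Finset (Module.Basis.ofVectorSpaceIndex ℚ ℝ) :=
    Finset.univ.biUnion fun e => (b.repr (x e)).support
  have hs : x = ∑ j ∈ s, (b j : ℝ) • fun e => (q j e : ℝ) := by
    funext e
    rw [Finset.sum_apply]
    conv_lhs => rw [← b.linearCombination_repr (x e), Finsupp.linearCombination_apply]
    rw [Finsupp.sum_of_support_subset (s := s) _
      (Finset.subset_biUnion_of_mem (fun e => (b.repr (x e)).support) (Finset.mem_univ e)) _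
      (by simp)]
    refine Finset.sum_congr rfl fun j _ => ?_
    simp [q, Rat.smul_def, mul_comm]
  -- As `A` has rational entries, it acts separately on each `ℚ`-coordinate of `x`, so every
  -- coefficient vector lies in its kernel.
  have hq : ∀ j i, ∑ e, (A i e : ℚ) * q j e = 0 := by
    intro j i
    have h := congrFun hx i
    have h2 := congrArg (fun y => b.repr y j) (show ∑ e, (A i e : ℚ) • x e = 0 by
      simpa [Matrix.mulVec, dotProduct, Rat.smul_def] using h)
    simpa [q] using h2
  rw [hs]
  refine Submodule.sum_mem _ fun j _ => Submodule.smul_mem _ _ ?_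
  -- A common denominator `d` turns the rational kernel vector into an integral one.
  obtain ⟨d, hd⟩ := IsLocalization.exist_integer_multiples_of_finite (nonZeroDivisors ℤ) (q j)
  choose z hz using hd
  have hd0 : ((d : ℤ) : ℝ) ≠ 0 := by
    exact_mod_cast nonZeroDivisors.coe_ne_zero d
  have hzq : ∀ e, (z e : ℚ) = (d : ℤ) * q j e := by
    intro e
    simpa using hz e
  have hz' : (fun e => (q j e : ℝ)) = ((d : ℤ) : ℝ)⁻¹ • fun e => (z e : ℝ) := by
    funext e
    have h : (z e : ℝ) = (d : ℤ) * (q j e : ℝ) := by exact_mod_cast congrArg (Rat.cast : ℚ → ℝ) (hzq e)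
    simp only [Pi.smul_apply, smul_eq_mul, h]
    field_simp
  rw [hz']
  refine Submodule.smul_mem _ _ (Submodule.subset_span ⟨z, ?_, rfl⟩)
  funext i
  have h : ((∑ e, A i e * z e : ℤ) : ℚ) = 0 := by
    push_cast
    simp only [hzq]
    calc ∑ e, (A i e : ℚ) * ((d : ℤ) * q j e) = (d : ℤ) * ∑ e, (A i e : ℚ) * q j e := by
          rw [Finset.mul_sum]
          exact Finset.sum_congr rfl fun e _ => by ring
      _ = 0 := by rw [hq, mul_zero]
  exact_mod_cast h

namespace WeightedChains

theorem inner_of {ι : Type u} [Fintype ι] (w : ι → ℝ) (x y : ι → ℝ) :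
    inner ℝ (of w x) (of w y) = ∑ b, Real.exp (w b) * x b * y b := rfl

end WeightedChains

namespace BasedComplex

variable (K : BasedComplex.{u}) (W : ∀ k, K.cells k → ℝ)

variable {K} in
theorem homologyClass_eq_iff {A : Type} [CommRing A] {k : ℕ} (x y : K.cycles A k) :
    K.homologyClass A k x = K.homologyClass A k y ↔ x.1 - y.1 ∈ K.boundaries A k :=
  Submodule.Quotient.eq _

theorem cycles_le_span_integral (k : ℕ) :
    K.cycles ℝ k ≤ Submodule.span ℝ (K.chainsIntCast k '' (K.cycles ℤ k : Set (K.cells k → ℤ))) := by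
  intro x hx
  cases k with
  | zero =>
    rw [pi_eq_sum_univ' x]
    refine Submodule.sum_mem _ fun e _ => Submodule.smul_mem _ _ (Submodule.subset_span ?_)
    refine ⟨Pi.single e 1, trivial, ?_⟩
    funext e'
    simp [chainsIntCast, Pi.single_apply, apply_ite]
  | succ k =>
    refine Submodule.span_mono ?_ (ker_intCast_le_span (K.bd k) x hx)
    rintro _ ⟨z, hz, rfl⟩
    refine ⟨z, ?_, rfl⟩
    change ((K.bd k).map (Int.cast : ℤ → ℤ)).mulVec z = 0
    rw [← hz]
    congr 1

theorem span_integralHomology (k : ℕ) :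
    Submodule.span ℝ (K.integralHomology k : Set (K.Homology ℝ k)) = ⊤ := by
  rw [eq_top_iff]
  rintro y -
  obtain ⟨⟨x, hx⟩, rfl⟩ := Submodule.mkQ_surjective _ y
  have key : ∀ x ∈ Submodule.span ℝ (K.chainsIntCast k '' (K.cycles ℤ k : Set (K.cells k → ℤ))),
      ∀ hx : x ∈ K.cycles ℝ k, K.homologyClass ℝ k ⟨x, hx⟩ ∈
        Submodule.span ℝ (K.integralHomology k : Set (K.Homology ℝ k)) := by
    intro x hx
    have hle : Submodule.span ℝ (K.chainsIntCast k '' (K.cycles ℤ k : Set (K.cells k → ℤ))) ≤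
        K.cycles ℝ k := by
      rw [Submodule.span_le]
      rintro _ ⟨z, hz, rfl⟩
      exact K.chainsIntCast_mem_cycles k z hz
    induction hx using Submodule.span_induction with
    | mem x hx =>
      intro _
      obtain ⟨z, hz, rfl⟩ := hx
      exact Submodule.subset_span ⟨Submodule.Quotient.mk ⟨z, hz⟩, rfl⟩
    | zero => exact fun _ => (map_zero (K.homologyClass ℝ k)).symm ▸ zero_mem _
    | add x y hx hy ihx ihy =>
      intro _
      exact add_mem (ihx (hle hx)) (ihy (hle hy))
    | smul a x hx ih =>
      intro _
      exact Submodule.smul_mem _ a (ih (hle hx))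
  exact key x (K.cycles_le_span_integral k hx) hx

variable {K} in
/-- A combinatorial homology basis is a basis of real homology. -/
noncomputable def CombinatorialBasis.real (h : K.CombinatorialBasis) (k : ℕ) :
    Module.Basis (Fin (K.betti k)) ℝ (K.Homology ℝ k) :=
  -- Independence over `ℤ` does not by itself give independence over `ℝ`; the latter follows because
  -- `β_k` vectors span a space of dimension `β_k`.
  basisOfTopLeSpanOfCardEqFinrank (fun i => (h k i : K.Homology ℝ k))
    (by
      rw [← K.span_integralHomology k, Submodule.span_le]
      intro x hx
      have h1 := (h k).sum_repr ⟨x, hx⟩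
      have h2 := congrArg Subtype.val h1
      simp only [Submodule.coe_sum, Submodule.coe_smul] at h2
      rw [← h2]
      exact Submodule.sum_mem _ fun i _ =>
        zsmul_mem (Submodule.subset_span (Set.mem_range_self i)) _)
    (Fintype.card_fin _)

variable {K} in
@[simp]
theorem CombinatorialBasis.real_apply (h : K.CombinatorialBasis) (k : ℕ) (i : Fin (K.betti k)) :
    h.real k i = (h k i : K.Homology ℝ k) :=
  congrFun (coe_basisOfTopLeSpanOfCardEqFinrank _ _ _) i

/-! ### Harmonic representatives and the covolume -/

theorem harmonicClass_injective (k : ℕ) : Function.Injective (K.harmonicClass W k) := by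
  rw [injective_iff_map_eq_zero]
  intro x hx
  have h1 : (WeightedChains.of (W k)).symm x.1 ∈ K.boundaries ℝ k := by
    have h0 := (homologyClass_eq_iff (⟨_, K.harmonic_mem_cycles W k x⟩ : K.cycles ℝ k) 0).1
      (hx.trans (map_zero _).symm)
    simpa using h0
  have h2 : x.1 ∈ K.boundariesW W k := ⟨_, h1, rfl⟩
  exact Subtype.ext (inner_self_eq_zero.1 ((Submodule.mem_orthogonal _ _).1 x.2.2 _ h2))

/-- Subtracting from a cycle its orthogonal projection to `B_k` leaves a harmonic cycle in the same
class. -/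
theorem harmonicClass_surjective (k : ℕ) : Function.Surjective (K.harmonicClass W k) := by
  intro y
  obtain ⟨⟨x, hx⟩, rfl⟩ := Submodule.mkQ_surjective _ y
  obtain ⟨_, ⟨p, hp, rfl⟩, q, hq, hpq⟩ :=
    (K.boundariesW W k).exists_add_mem_mem_orthogonal (WeightedChains.of (W k) x)
  have hpq' : x = p + (WeightedChains.of (W k)).symm q := hpq
  have hqx : (WeightedChains.of (W k)).symm q = x - p := by rw [hpq']; abel
  refine ⟨⟨q, ⟨_, ?_, rfl⟩, hq⟩, ?_⟩
  · change (WeightedChains.of (W k)).symm q ∈ _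
    rw [hqx]
    exact sub_mem hx (K.boundaries_le_cycles ℝ k hp)
  · refine (homologyClass_eq_iff _ _).2 ?_
    change (WeightedChains.of (W k)).symm q - x ∈ K.boundaries ℝ k
    rw [hqx, sub_sub_cancel_left]
    exact neg_mem hp

/-- The isomorphism from harmonic chains to homology. -/
noncomputable def harmonicEquiv (k : ℕ) : K.harmonic W k ≃ₗ[ℝ] K.Homology ℝ k :=
  LinearEquiv.ofBijective (K.harmonicClass W k)
    ⟨K.harmonicClass_injective W k, K.harmonicClass_surjective W k⟩

variable {K} in
/-- The basis of the space of harmonic chains given by a combinatorial homology basis. -/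
noncomputable def CombinatorialBasis.harmonic (h : K.CombinatorialBasis) (k : ℕ) :
    Module.Basis (Fin (K.betti k)) ℝ (K.harmonic W k) :=
  (h.real k).map (K.harmonicEquiv W k).symm

variable {K} in
theorem CombinatorialBasis.harmonicClass_harmonic (h : K.CombinatorialBasis) (k : ℕ)
    (i : Fin (K.betti k)) :
    K.harmonicClass W k (h.harmonic W k i) = (h k i : K.Homology ℝ k) := by
  rw [CombinatorialBasis.harmonic, Module.Basis.map_apply, ← h.real_apply]
  exact (K.harmonicEquiv W k).apply_symm_apply _

variable {K} in
-- By injectivity of `harmonicClass`, the lattice is the `ℤ`-span of the harmonic representatives of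
-- `h_k`, so `covolume_sq_eq_det_gram` applies.
theorem eta_eq_det_gram (h : K.CombinatorialBasis) (k : ℕ) :
    K.eta W k = (Matrix.gram ℝ fun i =>
      (h.harmonic W k i : WeightedChains (W k))).det := by
  refine covolume_sq_eq_det_gram (h.harmonic W k) (K.harmonicLattice W k) (le_antisymm ?_ ?_)
  · intro x hx
    have hx' : K.harmonicClass W k x ∈ K.integralHomology k := hx
    have h2 := congrArg Subtype.val ((h k).sum_repr ⟨_, hx'⟩)
    simp only [Submodule.coe_sum, Submodule.coe_smul] at h2
    have h3 : x = ∑ i, (h k).repr ⟨_, hx'⟩ i • h.harmonic W k i := by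
      apply K.harmonicClass_injective W k
      rw [map_sum]
      refine h2.symm.trans (Finset.sum_congr rfl fun i _ => by
        rw [map_zsmul, h.harmonicClass_harmonic])
    rw [h3]
    exact Submodule.sum_mem _ fun i _ => Submodule.smul_mem _ _ (Submodule.subset_span ⟨i, rfl⟩)
  · rw [Submodule.span_le]
    rintro _ ⟨i, rfl⟩
    change K.harmonicClass W k (h.harmonic W k i) ∈ K.integralHomology k
    rw [h.harmonicClass_harmonic]
    exact (h k i).2

/-! ### The torsion determinant in a single degree -/

variable {K}

/-- With `M` the change of basis matrix and `E` the diagonal matrix of the weights `exp (W k b)`,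
the Gram matrix is `Mᵀ * E * M` up to reindexing by `card_cells`. -/
theorem TorsionChoices.det_changeOfBasis_sq (c : K.TorsionChoices)
    (h : ∀ k, Fin (K.betti k) → K.Homology ℝ k) (k : ℕ) :
    (c.changeOfBasis h k).det ^ 2 * ∏ b, Real.exp (W k b) =
      (Matrix.gram ℝ fun j => WeightedChains.of (W k) (c.combinedBasis h k j)).det := by
  have h1 : (Matrix.gram ℝ fun j => WeightedChains.of (W k) (c.combinedBasis h k j)).submatrix
      (finCongr (K.card_cells k).symm) (finCongr (K.card_cells k).symm) =
      (c.changeOfBasis h k).transpose *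
        Matrix.diagonal (fun i => Real.exp (W k (c.order k i))) * c.changeOfBasis h k := by
    ext i j
    rw [Matrix.mul_apply, Matrix.submatrix_apply, Matrix.gram_apply, WeightedChains.inner_of,
      ← (c.order k).sum_comp]
    refine Finset.sum_congr rfl fun l _ => ?_
    rw [Matrix.mul_diagonal, mul_comm (Real.exp _)]
    rfl
  rw [← Matrix.det_submatrix_equiv_self (finCongr (K.card_cells k).symm), h1, Matrix.det_mul,
    Matrix.det_mul, Matrix.det_transpose, Matrix.det_diagonal,
    (c.order k).prod_comp fun b => Real.exp (W k b)]
  ring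

/-- The Gram determinant of the chosen basis of the space of boundaries. -/
noncomputable def TorsionChoices.boundaryGram (c : K.TorsionChoices) (k : ℕ) : ℝ :=
  (Matrix.gram ℝ fun i => WeightedChains.of (W k) (c.b k i)).det

/-- The Gram determinant of the projections of the lifted basis to the orthogonal complement of
the cycles. -/
noncomputable def TorsionChoices.liftedGram (c : K.TorsionChoices) : ℕ → ℝ
  | 0 => 1
  | k + 1 => c.boundaryGram W k / LinearMap.det (K.laplacian W k)

theorem TorsionChoices.boundaryGram_ne_zero (c : K.TorsionChoices) (k : ℕ) :
    c.boundaryGram W k ≠ 0 := by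
  refine Matrix.det_gram_ne_zero_iff_linearIndependent.2 ?_
  exact ((c.b k).linearIndependent.map' (K.boundaries ℝ k).subtype (Submodule.ker_subtype _)).map'
    (WeightedChains.of (W k)).toLinearMap (WeightedChains.of (W k)).ker

theorem cyclesW_succ (k : ℕ) : K.cyclesW W (k + 1) = LinearMap.ker (K.boundaryW W k) := by
  ext x
  constructor
  · rintro ⟨y, hy, rfl⟩
    exact hy
  · intro hx
    exact ⟨x, hx, rfl⟩

/-- Removing the component of a lift in `Z_{k+1} = ker ∂` does not change its boundary. The
corrected lifts thus still map to `b_k` and lie in `(ker ∂)ᗮ`, as `det_gram_mul_det_comp_adjoint`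
requires. -/
theorem TorsionChoices.exists_lift (c : K.TorsionChoices) (k : ℕ) :
    ∃ w : Fin (K.bdRank k) → WeightedChains (W (k + 1)),
      (∀ i, WeightedChains.of (W (k + 1)) (c.s k (c.b k i)) - w i ∈ K.cyclesW W (k + 1)) ∧
      (∀ i, w i ∈ (K.cyclesW W (k + 1))ᗮ) ∧
      (Matrix.gram ℝ w).det * LinearMap.det (K.laplacian W k) = c.boundaryGram W k := by
  choose p hp w hw hpw using fun i => (K.cyclesW W (k + 1)).exists_add_mem_mem_orthogonal
    (WeightedChains.of (W (k + 1)) (c.s k (c.b k i)))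
  refine ⟨w, fun i => ?_, hw, ?_⟩
  · rw [hpw, add_sub_cancel_right]
    exact hp i
  · let b : Module.Basis (Fin (K.bdRank k)) ℝ (K.boundariesW W k) :=
      (c.b k).map ((WeightedChains.of (W k)).submoduleMap (K.boundaries ℝ k))
    refine det_gram_mul_det_comp_adjoint (K.boundaryW W k) (K.boundariesW W k) b
      (K.laplacian W k) (fun x => rfl) w (fun i => ?_) (fun i => ?_)
    · rw [← cyclesW_succ]
      exact hw i
    · have h1 : w i = WeightedChains.of (W (k + 1)) (c.s k (c.b k i)) - p i := by
        rw [hpw]; abel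
      have h2 : K.boundaryW W k (p i) = 0 := by
        rw [← LinearMap.mem_ker, ← cyclesW_succ]
        exact hp i
      rw [h1, map_sub, h2, sub_zero]
      exact congrArg (WeightedChains.of (W k)) (c.boundary_s k (c.b k i))

theorem TorsionChoices.det_laplacian_ne_zero (c : K.TorsionChoices) (k : ℕ) :
    LinearMap.det (K.laplacian W k) ≠ 0 := by
  obtain ⟨w, -, -, hw⟩ := c.exists_lift W k
  exact right_ne_zero_of_mul (hw ▸ c.boundaryGram_ne_zero W k)

theorem TorsionChoices.liftedGram_ne_zero (c : K.TorsionChoices) (k : ℕ) :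
    c.liftedGram W k ≠ 0 := by
  cases k with
  | zero => exact one_ne_zero
  | succ k => exact div_ne_zero (c.boundaryGram_ne_zero W k) (c.det_laplacian_ne_zero W k)

/-- Shows that the quotient defining `liftedGram` is a genuine Gram determinant; in degree `0` it is
an empty determinant. -/
theorem TorsionChoices.exists_liftedBasis_projection (c : K.TorsionChoices) (k : ℕ) :
    ∃ w : Fin (K.prevBdRank k) → WeightedChains (W k),
      (∀ i, WeightedChains.of (W k) (c.liftedBasis k i) - w i ∈ K.cyclesW W k) ∧
      (∀ i, w i ∈ (K.cyclesW W k)ᗮ) ∧ (Matrix.gram ℝ w).det = c.liftedGram W k := by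
  cases k with
  | zero => exact ⟨fun i => i.elim0, fun i => i.elim0, fun i => i.elim0, Matrix.det_fin_zero⟩
  | succ k =>
    obtain ⟨w, h1, h2, h3⟩ := c.exists_lift W k
    exact ⟨w, h1, h2, eq_div_of_mul_eq (c.det_laplacian_ne_zero W k) h3⟩

/-- The contribution of degree `k` to the torsion formula. -/
theorem TorsionChoices.det_changeOfBasis_sq_eq (c : K.TorsionChoices) (h : K.CombinatorialBasis)
    (k : ℕ) :
    (c.changeOfBasis (fun k i => (h k i : K.Homology ℝ k)) k).det ^ 2 *
        ∏ b, Real.exp (W k b) =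
      c.boundaryGram W k * K.eta W k * c.liftedGram W k := by
  obtain ⟨w, hw1, hw2, hw3⟩ := c.exists_liftedBasis_projection W k
  let ob : Fin (K.bdRank k) → WeightedChains (W k) := fun i => WeightedChains.of (W k) (c.b k i)
  let ot : Fin (K.betti k) → WeightedChains (W k) :=
    fun i => WeightedChains.of (W k) (c.t k (h k i))
  have hbspan : Submodule.span ℝ (Set.range ob) = K.boundariesW W k := by
    have h1 : Set.range ob =
        ((WeightedChains.of (W k)).toLinearMap ∘ₗ (K.boundaries ℝ k).subtype) ''
          Set.range (c.b k) := by
      rw [← Set.range_comp]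
      rfl
    rw [h1, Submodule.span_image, (c.b k).span_eq, Submodule.map_top, LinearMap.range_comp,
      Submodule.range_subtype]
    rfl
  have hob : ∀ i, ob i ∈ K.boundariesW W k := fun i => ⟨_, (c.b k i).2, rfl⟩
  have hbz : K.boundariesW W k ≤ K.cyclesW W k := Submodule.map_mono (K.boundaries_le_cycles ℝ k)
  have hot : ∀ i, ot i ∈ K.cyclesW W k := fun i => ⟨_, (c.t k (h k i)).2, rfl⟩
  -- A cycle differs by a boundary from `t_k` of its class, and that class is a real combination of
  -- `h_k`.
  have hzspan : K.cyclesW W k ≤ Submodule.span ℝ (Set.range (Sum.elim ob ot)) := by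
    rintro _ ⟨z, hz, rfl⟩
    have h1 : ((c.t k (K.homologyClass ℝ k ⟨z, hz⟩) : K.cycles ℝ k) : K.cells k → ℝ) - z ∈
        K.boundaries ℝ k :=
      (homologyClass_eq_iff _ _).1 (c.homologyClass_t k (K.homologyClass ℝ k ⟨z, hz⟩))
    have h2 : (WeightedChains.of (W k))
        ((c.t k (K.homologyClass ℝ k ⟨z, hz⟩) : K.cycles ℝ k) : K.cells k → ℝ) -
          WeightedChains.of (W k) z ∈ Submodule.span ℝ (Set.range (Sum.elim ob ot)) := by
      rw [Set.Sum.elim_range, Submodule.span_union, hbspan]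
      exact Submodule.mem_sup_left ⟨_, h1, rfl⟩
    have h3 : (WeightedChains.of (W k))
        ((c.t k (K.homologyClass ℝ k ⟨z, hz⟩) : K.cycles ℝ k) : K.cells k → ℝ) ∈
          Submodule.span ℝ (Set.range (Sum.elim ob ot)) := by
      rw [← (h.real k).sum_repr (K.homologyClass ℝ k ⟨z, hz⟩), map_sum, Submodule.coe_sum, map_sum]
      refine Submodule.sum_mem _ fun i _ => ?_
      rw [map_smul, Submodule.coe_smul, map_smul, h.real_apply]
      exact Submodule.smul_mem _ _ (Submodule.subset_span ⟨Sum.inr i, rfl⟩)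
    exact (Submodule.sub_mem_iff_right _ h3).1 h2
  have hcomb : (fun j => WeightedChains.of (W k)
      (c.combinedBasis (fun k i => (h k i : K.Homology ℝ k)) k j)) =
      (Sum.elim (Sum.elim ob ot) (fun i => WeightedChains.of (W k) (c.liftedBasis k i))) ∘
        ((Equiv.sumCongr finSumFinEquiv (Equiv.refl _)).trans finSumFinEquiv).symm := by
    rw [Equiv.eq_comp_symm]
    funext j
    rcases j with (j | j) | j <;> simp [combinedBasis, ob, ot]
  -- The Gram determinant is split twice: the lifts are projected away from `Z_k`, then `t_k(h_k)`
  -- away from `B_k`, which yields the harmonic representatives.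
  rw [c.det_changeOfBasis_sq, hcomb, det_gram_comp_equiv, det_gram_sumElim _ _ w, hw3,
    det_gram_sumElim ob ot (fun i => (h.harmonic W k i : WeightedChains (W k))),
    ← eta_eq_det_gram]
  · rfl
  · intro j
    rw [hbspan]
    have h1 : K.homologyClass ℝ k (c.t k (h k j)) = K.harmonicClass W k (h.harmonic W k j) := by
      rw [c.homologyClass_t, h.harmonicClass_harmonic]
    exact ⟨_, (homologyClass_eq_iff _ _).1 h1, rfl⟩
  · intro i j
    exact (Submodule.mem_orthogonal _ _).1 (h.harmonic W k j).2.2 _ (hob i)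
  · exact fun j => hzspan (hw1 j)
  · intro i j
    refine (Submodule.mem_orthogonal _ _).1 (hw2 j) _ ?_
    cases i with
    | inl i => exact hbz (hob i)
    | inr i => exact hot i

theorem eta_ne_zero (h : K.CombinatorialBasis) (k : ℕ) : K.eta W k ≠ 0 := by
  rw [eta_eq_det_gram W h]
  exact Matrix.det_gram_ne_zero_iff_linearIndependent.2
    ((h.harmonic W k).linearIndependent.map' (K.harmonic W k).subtype (Submodule.ker_subtype _))

end BasedComplex

/-! ### Alternating products -/

theorem finprod_cond_eq_prod_range {M : Type*} [CommMonoid M] (p : ℕ → Prop) [DecidablePred p]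
    (f : ℕ → M) (N : ℕ) (hf : ∀ k, N ≤ k → f k = 1) :
    ∏ᶠ (k : ℕ) (_ : p k), f k = ∏ k ∈ Finset.range N, if p k then f k else 1 := by
  have h1 : ∀ k, (∏ᶠ (_ : p k), f k) = if p k then f k else 1 := fun k => finprod_eq_if
  simp only [h1]
  refine finprod_eq_prod_of_mulSupport_subset _ fun k hk => ?_
  rw [Finset.coe_range, Set.mem_Iio]
  by_contra hkN
  exact hk (by simp [hf k (not_lt.1 hkN)])

theorem finprod_even_div_finprod_odd (f : ℕ → ℝ) (N : ℕ) (hf : ∀ k, N ≤ k → f k = 1) :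
    (∏ᶠ (k : ℕ) (_ : Even k), f k) / (∏ᶠ (k : ℕ) (_ : Odd k), f k) =
      ∏ k ∈ Finset.range N, f k ^ ((-1 : ℤ) ^ k) := by
  rw [finprod_cond_eq_prod_range _ _ N hf, finprod_cond_eq_prod_range _ _ N hf,
    ← Finset.prod_div_distrib]
  refine Finset.prod_congr rfl fun k _ => ?_
  rcases Nat.even_or_odd k with hk | hk
  · simp [hk, hk.neg_one_pow, Nat.not_odd_iff_even.2 hk]
  · simp [hk, hk.neg_one_pow, Nat.not_even_iff_odd.2 hk]

/-- Each interior `p k` occurs in two neighbouring factors with opposite exponents and cancels; only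
the two ends remain. -/
theorem prod_range_mul_succ_zpow_neg_one_pow (p : ℕ → ℝ) (hp : ∀ k, p k ≠ 0) (N : ℕ) :
    ∏ k ∈ Finset.range N, (p k * p (k + 1)) ^ ((-1 : ℤ) ^ k) = p 0 / p N ^ ((-1 : ℤ) ^ N) := by
  induction N with
  | zero => simp [hp 0]
  | succ N ih =>
    have h1 : p N ^ ((-1 : ℤ) ^ N) ≠ 0 := zpow_ne_zero _ (hp N)
    rw [Finset.prod_range_succ, ih, mul_zpow, pow_succ, mul_neg_one, zpow_neg, div_inv_eq_mul]
    field_simp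

/-! ### Combining all degrees -/

namespace BasedComplex

variable {K : BasedComplex.{u}} (W : ∀ k, K.cells k → ℝ)

theorem subsingleton_weightedChains (k : ℕ) [IsEmpty (K.cells k)] :
    Subsingleton (WeightedChains (W k)) :=
  inferInstanceAs (Subsingleton (K.cells k → ℝ))

theorem det_laplacian_eq_one (k : ℕ) [IsEmpty (K.cells k)] :
    LinearMap.det (K.laplacian W k) = 1 := by
  have := subsingleton_weightedChains W k
  exact LinearMap.det_eq_one_of_subsingleton _

theorem TorsionChoices.boundaryGram_eq_one (c : K.TorsionChoices) (k : ℕ) [IsEmpty (K.cells k)] :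
    c.boundaryGram W k = 1 := by
  have : IsEmpty (Fin (K.bdRank k)) := by
    rw [bdRank, Module.finrank_zero_of_subsingleton]
    infer_instance
  exact Matrix.det_isEmpty

theorem eta_eq_one (h : K.CombinatorialBasis) (k : ℕ) [IsEmpty (K.cells k)] :
    K.eta W k = 1 := by
  have : Subsingleton (K.Homology ℝ k) := (Submodule.mkQ_surjective _).subsingleton
  have : IsEmpty (Fin (K.betti k)) := by
    rw [betti, Module.finrank_zero_of_subsingleton]
    infer_instance
  rw [eta_eq_det_gram W h]
  exact Matrix.det_isEmpty

theorem TorsionChoices.det_changeOfBasis_eq_one (c : K.TorsionChoices)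
    (h : ∀ k, Fin (K.betti k) → K.Homology ℝ k) (k : ℕ) [IsEmpty (K.cells k)] :
    (c.changeOfBasis h k).det = 1 := by
  have : IsEmpty (Fin (Fintype.card (K.cells k))) := by
    rw [Fintype.card_eq_zero]
    infer_instance
  exact Matrix.det_isEmpty

/-- The torsion formula for a based chain complex with finitely many basis elements. -/
theorem torsion_sq (c : K.TorsionChoices) (h : K.CombinatorialBasis)
    (hfin : ∀ᶠ k in Filter.atTop, IsEmpty (K.cells k)) :
    torsion c (fun k i => (h k i : K.Homology ℝ k)) ^ 2 =
      ((∏ᶠ (k : ℕ) (_ : Even k), LinearMap.det (K.laplacian W k)) /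
        (∏ᶠ (k : ℕ) (_ : Odd k), LinearMap.det (K.laplacian W k))) *
      ((∏ᶠ (k : ℕ) (_ : Odd k), ∏ b, Real.exp (W k b)) /
        (∏ᶠ (k : ℕ) (_ : Even k), ∏ b, Real.exp (W k b))) *
      ((∏ᶠ (k : ℕ) (_ : Even k), K.eta W k) / (∏ᶠ (k : ℕ) (_ : Odd k), K.eta W k)) := by
  obtain ⟨N, hN⟩ := Filter.eventually_atTop.1 hfin
  -- The products are cut at `N + 1`, not `N`, because `liftedGram` in degree `N + 1` is built from
  -- data of degree `N`, which must already be trivial.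
  have hN' : ∀ k, N + 1 ≤ k → IsEmpty (K.cells k) := fun k hk => hN k (by omega)
  have hT : torsion c (fun k i => (h k i : K.Homology ℝ k)) =
      ∏ k ∈ Finset.range (N + 1),
        (c.changeOfBasis (fun k i => (h k i : K.Homology ℝ k)) k).det ^ ((-1 : ℤ) ^ k) := by
    refine finprod_eq_prod_of_mulSupport_subset _ fun k hk => ?_
    rw [Finset.coe_range, Set.mem_Iio]
    by_contra hkN
    have := hN' k (not_lt.1 hkN)
    exact hk (by simp [c.det_changeOfBasis_eq_one])
  have hlast : c.liftedGram W (N + 1) = 1 := by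
    have := hN N le_rfl
    rw [TorsionChoices.liftedGram, c.boundaryGram_eq_one, det_laplacian_eq_one, div_one]
  have hexp : ∀ k, (∏ b, Real.exp (W k b)) ≠ 0 := fun k =>
    Finset.prod_ne_zero_iff.2 fun b _ => (Real.exp_pos _).ne'
  -- Here `boundaryGram` in degree `k` is rewritten as `det 𝓛_k` times `liftedGram` in degree `k +
  -- 1`, which prepares the telescoping.
  have hterm : ∀ k, (c.changeOfBasis (fun k i => (h k i : K.Homology ℝ k)) k).det ^ 2 =
      LinearMap.det (K.laplacian W k) * (∏ b, Real.exp (W k b))⁻¹ * K.eta W k *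
        (c.liftedGram W k * c.liftedGram W (k + 1)) := by
    intro k
    have h1 := c.det_changeOfBasis_sq_eq W h k
    have h2 := c.det_laplacian_ne_zero W k
    have h3 := hexp k
    rw [TorsionChoices.liftedGram]
    field_simp
    rw [h1]
    ring
  have hlift := prod_range_mul_succ_zpow_neg_one_pow (c.liftedGram W) (c.liftedGram_ne_zero W) (N + 1)
  rw [hlast, TorsionChoices.liftedGram, one_zpow, div_one] at hlift
  -- The telescoped product `hlift`, equal to `1`, is inserted as a factor on the right, so that the
  -- two sides can be compared degree by degree through `hterm`.
  rw [← inv_div (∏ᶠ (k : ℕ) (_ : Even k), ∏ b, Real.exp (W k b)),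
    finprod_even_div_finprod_odd _ (N + 1) fun k hk => by
      have := hN' k hk
      exact det_laplacian_eq_one W k,
    finprod_even_div_finprod_odd _ (N + 1) fun k hk => by
      have := hN' k hk
      exact Finset.prod_of_isEmpty _,
    finprod_even_div_finprod_odd _ (N + 1) fun k hk => by
      have := hN' k hk
      exact eta_eq_one W h k,
    hT, ← Finset.prod_pow, ← Finset.prod_inv_distrib, ← Finset.prod_mul_distrib,
    ← Finset.prod_mul_distrib, ← mul_one (∏ k ∈ _, _ * _), ← hlift, ← Finset.prod_mul_distrib]
  refine Finset.prod_congr rfl fun k _ => ?_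
  rw [← inv_zpow, ← mul_zpow, ← mul_zpow, ← mul_zpow, ← hterm, ← zpow_natCast, ← zpow_natCast,
    zpow_comm]

end BasedComplex

theorem mainTheorem7 {X : Type u} [TopologicalSpace X] [T2Space X] (C : Set X)
    [CWComplex C] [RelCWComplex.Finite C] (_hconn : IsConnected C)
    (o : CellOrientation C)
    (W : ∀ k, (cellularComplex o).cells k → ℝ)
    (h : (cellularComplex o).CombinatorialBasis)
    (c : (cellularComplex o).TorsionChoices) :
    BasedComplex.torsion c (fun k i => (h k i : (cellularComplex o).Homology ℝ k)) ^ 2 =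
      ((∏ᶠ (k : ℕ) (_ : Even k), LinearMap.det ((cellularComplex o).laplacian W k)) /
        (∏ᶠ (k : ℕ) (_ : Odd k), LinearMap.det ((cellularComplex o).laplacian W k))) *
      ((∏ᶠ (k : ℕ) (_ : Odd k), ∏ b, Real.exp (W k b)) /
        (∏ᶠ (k : ℕ) (_ : Even k), ∏ b, Real.exp (W k b))) *
      ((∏ᶠ (k : ℕ) (_ : Even k), (cellularComplex o).eta W k) /
        (∏ᶠ (k : ℕ) (_ : Odd k), (cellularComplex o).eta W k)) :=
  BasedComplex.torsion_sq W c h RelCWComplex.FiniteDimensional.eventually_isEmpty_cell
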